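/- Let $A$ be a quantum system of finite dimension $d\ge 1$ with a fixed orthonormal (incoherent) basis $\{|i\rangle\}_{i=0}^{d-1}$, and let $\Delta_A(O)=\sum_i\langle i|O|i\rangle\,|i\rangle\langle i|$ be the dephasing channel. A measurement $\mathcal M=\{M_x\}$ is a POVM with finitely many outcomes; it is incoherent, $\mathcal M\in\mathbf{IM}$, if every $M_x$ is diagonal in the incoherent basis (for a system $A\widetilde A$: in the product of the incoherent bases). For a channel $\mathcal E$ with adjoint $\mathcal E^\dagger$, $\mathcal M\circ\mathcal E$ is the measurement $\{\mathcal E^\dagger(M_x)\}$. A channel $\mathcal F_A$ is in $\mathbf{DIO}$ (detection-incoherent) if $\Delta_A\circ\mathcal F_A=\Delta_A\circ\mathcal F_A\circ\Delta_A$. For positive semidefinite operators let $D(P\Vert Q)=\operatorname{tr}P(\log P-\log Q)$ if $\operatorname{supp}P\subseteq\operatorname{supp}Q$ and $D(P\Vert Q)=+\infty$ otherwise. For measurements $\mathcal M,\mathcal N$ with the same outcomes on a system of dimension $D_0$ let $$D_m(\mathcal M\Vert\mathcal N)=\frac1{D_0}\sum_x D(M_x\Vert N_x),\qquad C_m(\mathcal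 M)=\min_{\mathcal N\in\mathbf{IM}}D_m(\mathcal M\Vert\mathcal N),$$ where $\mathcal N$ has the same outcomes as $\mathcal M$. The measurement-cohering power of a quantum channel $\mathcal E_A$ on $A$ is $$C(\mathcal E_A)=\min_{\mathcal F_A\in\mathbf{DIO}}\ \max_{\mathcal M_{A\widetilde A}\in\mathbf{IM}}D_m\bigl(\mathcal M_{A\widetilde A}\circ(\mathcal E_A\otimes\mathsf{id}_{\widetilde A})\,\big\Vert\,\mathcal M_{A\widetilde A}\circ(\mathcal F_A\otimes\mathsf{id}_{\widetilde A})\bigr),$$ where the maximum is over ancillary systems $\widetilde A$ of arbitrary finite dimension and incoherent measurements of $A\widetilde A$ with an arbitrary finite number of outcomes. Then for every quantum channel $\mathcal E_A$ on $A$, $$C(\mathcal E_A)=\max_{\mathcal M_A\in\mathbf{IM}}C_m(\mathcal M_A\circ\mathcal E_A)=C_m(\mathcal I_A\circ\mathcal E_A),$$ where the maximum is over incoherent measurements of $A$ with an arbitrary finite number of outcomes and $\mathcal I_A=\{|i\rangle\langle i|\}_{i=0}^{d-1}$ is the incoherent-basis measurement. All the minima and maxima in $C(\mathcal E_A)$,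 in $C_m(\mathcal M_A\circ\mathcal E_A)$ for $\mathcal M_A\in\mathbf{IM}$, and in this equation are attained. -/

import Mathlib

open scoped ComplexOrder

noncomputable section

namespace MeasCoh

/-! Finite-dimensional quantum systems. A system with index type `A` has Hilbert space `ℂ^A`, and
its incoherent basis is the standard basis indexed by `A`. -/

section Basic

variable {A K X : Type*}

/-- The map `Φ ⊗ id_K` on operators on `ℂ^A ⊗ ℂ^K`: `Φ` applied to every block
`⟨k| Z |l⟩`, which is an operator on `ℂ^A`. -/
def ampliation (K : Type*) (Φ : Matrix A A ℂ →ₗ[ℂ] Matrix A A ℂ) :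
    Matrix (A × K) (A × K) ℂ →ₗ[ℂ] Matrix (A × K) (A × K) ℂ where
  toFun Z := Matrix.of fun p q => Φ (Matrix.of fun a b => Z (a, p.2) (b, q.2)) p.1 q.1
  map_add' Y Z := by
    ext p q
    exact congrFun (congrFun (map_add Φ (Matrix.of fun a b => Y (a, p.2) (b, q.2))
      (Matrix.of fun a b => Z (a, p.2) (b, q.2))) p.1) q.1
  map_smul' c Z := by
    ext p q
    exact congrFun (congrFun (map_smul Φ c (Matrix.of fun a b => Z (a, p.2) (b, q.2))) p.1) q.1

/-- Complete positivity: `Φ ⊗ id_k` is positive for every `k`. -/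
def IsCompletelyPositive (Φ : Matrix A A ℂ →ₗ[ℂ] Matrix A A ℂ) : Prop :=
  ∀ (k : ℕ) (Z : Matrix (A × Fin k) (A × Fin k) ℂ), Z.PosSemidef →
    (ampliation (Fin k) Φ Z).PosSemidef

theorem IsCompletelyPositive.ampliation_posSemidef [Fintype K]
    {Φ : Matrix A A ℂ →ₗ[ℂ] Matrix A A ℂ} (h : IsCompletelyPositive Φ)
    {Z : Matrix (A × K) (A × K) ℂ} (hZ : Z.PosSemidef) : (ampliation K Φ Z).PosSemidef := by
  let e := Fintype.equivFin K
  have h1 := h _ _ (hZ.submatrix (Prod.map (id : A → A) e.symm))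
  have h2 := h1.submatrix (Prod.map (id : A → A) e)
  convert h2 using 1
  ext p q
  simp [ampliation]

theorem IsCompletelyPositive.ampliation [Fintype K]
    {Φ : Matrix A A ℂ →ₗ[ℂ] Matrix A A ℂ} (h : IsCompletelyPositive Φ) :
    IsCompletelyPositive (ampliation K Φ) := by
  intro k Z hZ
  have h1 := h.ampliation_posSemidef (K := K × Fin k)
    (hZ.submatrix (Equiv.prodAssoc A K (Fin k)).symm)
  exact h1.submatrix (Equiv.prodAssoc A K (Fin k))

theorem IsCompletelyPositive.map_posSemidef
    {Φ : Matrix A A ℂ →ₗ[ℂ] Matrix A A ℂ} (h : IsCompletelyPositive Φ)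
    {Z : Matrix A A ℂ} (hZ : Z.PosSemidef) : (Φ Z).PosSemidef := by
  have h1 := h.ampliation_posSemidef (K := Unit) (hZ.submatrix Prod.fst)
  exact h1.submatrix (fun a => (a, ()))

variable [Fintype A] [DecidableEq A]

/-- A quantum channel on the system `A`: a completely positive trace-preserving linear map. -/
structure Channel (A : Type*) [Fintype A] [DecidableEq A] where
  toMap : Matrix A A ℂ →ₗ[ℂ] Matrix A A ℂ
  completelyPositive : IsCompletelyPositive toMap
  trace_map : ∀ Z, (toMap Z).trace = Z.trace

/-- The channel `E ⊗ id_K`. -/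
def Channel.tensorId (E : Channel A) (K : Type*) [Fintype K] [DecidableEq K] :
    Channel (A × K) where
  toMap := ampliation K E.toMap
  completelyPositive := E.completelyPositive.ampliation
  trace_map Z := by
    have h := fun k : K => E.trace_map (Matrix.of fun a b => Z (a, k) (b, k))
    simp only [Matrix.trace, Matrix.diag, Fintype.sum_prod_type_right, Matrix.of_apply] at h ⊢
    exact Finset.sum_congr rfl fun k _ => h k

/-- The dephasing map `Δ(O) = ∑ i, ⟨i|O|i⟩ |i⟩⟨i|`. -/
def dephase (A : Type*) [Fintype A] [DecidableEq A] : Matrix A A ℂ →ₗ[ℂ] Matrix A A ℂ where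
  toFun O := Matrix.diagonal O.diag
  map_add' Y Z := by simp
  map_smul' c Z := by simp

/-- Detection-incoherent channels: `Δ ∘ F = Δ ∘ F ∘ Δ`. -/
def Channel.IsDetectionIncoherent (F : Channel A) : Prop :=
  dephase A ∘ₗ F.toMap = dephase A ∘ₗ F.toMap ∘ₗ dephase A

/-- A quantum measurement (POVM) on the system `A` with outcomes in `X`. -/
structure Measurement (A X : Type*) [Fintype A] [DecidableEq A] [Fintype X] where
  effect : X → Matrix A A ℂ
  posSemidef : ∀ x, (effect x).PosSemidef
  sum_effect : ∑ x, effect x = 1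

variable [Fintype X]

/-- The measurement as a channel with classical output:
`ρ ↦ ∑ x, tr(M x ρ) |x⟩⟨x|`. -/
def Measurement.apply [DecidableEq X] (M : Measurement A X) (ρ : Matrix A A ℂ) : Matrix X X ℂ :=
  Matrix.diagonal fun x => (M.effect x * ρ).trace

/-- A measurement is incoherent if all its POVM elements are fixed by `Δ`. -/
def Measurement.IsIncoherent (M : Measurement A X) : Prop :=
  ∀ x, dephase A (M.effect x) = M.effect x

/-- The adjoint of `Φ` for the trace pairing (see `trace_adjoint_mul`). -/
def adjoint (Φ : Matrix A A ℂ →ₗ[ℂ] Matrix A A ℂ) (M : Matrix A A ℂ) : Matrix A A ℂ :=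
  Matrix.of fun i j => (M * Φ (Matrix.single j i 1)).trace

theorem trace_adjoint_mul (Φ : Matrix A A ℂ →ₗ[ℂ] Matrix A A ℂ) (M ρ : Matrix A A ℂ) :
    (adjoint Φ M * ρ).trace = (M * Φ ρ).trace := by
  conv_rhs => rw [Matrix.matrix_eq_sum_single ρ]
  simp only [map_sum, Finset.mul_sum, Matrix.trace_sum]
  have h : ∀ i j, (M * Φ (Matrix.single i j (ρ i j))).trace
      = adjoint Φ M j i * ρ i j := by
    intro i j
    have : Matrix.single i j (ρ i j) = ρ i j • Matrix.single i j (1 : ℂ) := by simp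
    rw [this, map_smul, Matrix.mul_smul, Matrix.trace_smul, smul_eq_mul, mul_comm]
    rfl
  rw [Finset.sum_congr rfl fun i _ => Finset.sum_congr rfl fun j _ => h i j]
  simp only [Matrix.trace, Matrix.diag, Matrix.mul_apply]
  exact Finset.sum_comm

theorem trace_mul_nonneg {P Q : Matrix A A ℂ} (hP : P.PosSemidef) (hQ : Q.PosSemidef) :
    0 ≤ (P * Q).trace := by
  obtain ⟨B, rfl⟩ : ∃ B : Matrix A A ℂ, Q = B.conjTranspose * B := by
    open scoped MatrixOrder in
    exact CStarAlgebra.nonneg_iff_eq_star_mul_self.mp hQ.nonneg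
  rw [← Matrix.mul_assoc, Matrix.trace_mul_comm, ← Matrix.mul_assoc]
  exact (hP.mul_mul_conjTranspose_same B).trace_nonneg

theorem adjoint_posSemidef {Φ : Matrix A A ℂ →ₗ[ℂ] Matrix A A ℂ} (h : IsCompletelyPositive Φ)
    {M : Matrix A A ℂ} (hM : M.PosSemidef) : (adjoint Φ M).PosSemidef := by
  have key : ∀ v : A → ℂ, 0 ≤ star v ⬝ᵥ (adjoint Φ M).mulVec v := by
    intro v
    have h1 := trace_mul_nonneg hM (h.map_posSemidef (Matrix.posSemidef_vecMulVec_self_star v))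
    rw [← trace_adjoint_mul, Matrix.mul_vecMulVec, Matrix.trace_vecMulVec,
      dotProduct_comm] at h1
    exact h1
  refine Matrix.PosSemidef.of_dotProduct_mulVec_nonneg ?_ key
  rw [← Matrix.isSymmetric_toEuclideanLin_iff, LinearMap.isSymmetric_iff_inner_map_self_real]
  intro v
  have h2 := key v
  have h3 : inner ℂ (Matrix.toEuclideanLin (adjoint Φ M) v) v
      = star (star v.ofLp ⬝ᵥ (adjoint Φ M).mulVec v.ofLp) := by
    rw [EuclideanSpace.inner_eq_star_dotProduct, Matrix.star_dotProduct, star_star,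
      Matrix.ofLp_toLpLin, Matrix.toLin'_apply, dotProduct_comm]
  rw [h3]
  exact congrArg star (Complex.conj_eq_iff_im.mpr (Complex.nonneg_iff.mp h2).2.symm)

/-- The measurement `M ∘ E`: apply the channel `E`, then measure `M`. Its POVM elements are the
images of those of `M` under the adjoint of `E`. -/
def Measurement.comp (M : Measurement A X) (E : Channel A) : Measurement A X where
  effect x := adjoint E.toMap (M.effect x)
  posSemidef x := adjoint_posSemidef E.completelyPositive (M.posSemidef x)
  sum_effect := by
    ext i j
    rw [Matrix.sum_apply]
    simp only [adjoint, Matrix.of_apply]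
    rw [← Matrix.trace_sum, ← Finset.sum_mul, M.sum_effect, one_mul, E.trace_map]
    by_cases hij : i = j
    · subst hij; simp
    · rw [Matrix.trace_single_eq_of_ne _ _ _ (Ne.symm hij), Matrix.one_apply_ne hij]

theorem Measurement.comp_apply [DecidableEq X] (M : Measurement A X) (E : Channel A)
    (ρ : Matrix A A ℂ) : (M.comp E).apply ρ = M.apply (E.toMap ρ) := by
  simp only [Measurement.apply, Measurement.comp, trace_adjoint_mul]

/-- The incoherent-basis measurement `{|i⟩⟨i|}`. -/
def incoherentBasisMeasurement (A : Type*) [Fintype A] [DecidableEq A] : Measurement A A where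
  effect i := Matrix.single i i 1
  posSemidef i := by
    rw [← Matrix.diagonal_single]
    refine Matrix.PosSemidef.diagonal fun j => ?_
    by_cases h : j = i <;> simp [h]
  sum_effect := by
    simp only [← Matrix.diagonal_single]
    ext i j
    by_cases h : i = j
    · subst h; simp [Matrix.sum_apply, Pi.single_apply]
    · simp [Matrix.sum_apply, h]

end Basic

section Entropy

variable {A X : Type*} [Fintype A] [DecidableEq A] [Fintype X]

open Classical in
/-- The quantum relative entropy `D(P‖Q) = tr P (log P - log Q)` of positive semidefinite
operators (not necessarily normalized), with value `+∞` unless `supp P ⊆ supp Q`, that is,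
`ker Q ⊆ ker P`. The convention `Real.log 0 = 0` restricts the logarithms to the supports. -/
def relEntropy (P Q : Matrix A A ℂ) : EReal :=
  if ∀ v : A → ℂ, Q.mulVec v = 0 → P.mulVec v = 0 then
    (((P * (cfc Real.log P - cfc Real.log Q)).trace.re : ℝ) : EReal)
  else ⊤

/-- The measurement relative entropy `D_m(M‖N) = (1/d) ∑ x, D(M x‖N x)`, with `d` the dimension
of the measured system. -/
def measRelEntropy (M N : Measurement A X) : EReal :=
  (((Fintype.card A : ℝ)⁻¹ : ℝ) : EReal) * ∑ x, relEntropy (M.effect x) (N.effect x)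

/-- The values `D_m(M‖F)` for incoherent measurements `F` with the outcomes of `M`. -/
def measCoherenceValues (M : Measurement A X) : Set EReal :=
  {v | ∃ F : Measurement A X, F.IsIncoherent ∧ v = measRelEntropy M F}

/-- The relative entropy of measurement-coherence `C_m(M) = min_F D_m(M‖F)`. -/
def measCoherence (M : Measurement A X) : EReal :=
  sInf (measCoherenceValues M)

/-- The values `D_m(M ∘ (E ⊗ id)‖M ∘ (F ⊗ id))`, for incoherent measurements `M` on the system
together with an ancilla of arbitrary dimension `k ≥ 1`, with an arbitrary number `n` of
outcomes. -/
def distinguishabilityValues (E F : Channel A) : Set EReal :=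
  {v | ∃ (k n : ℕ) (M : Measurement (A × Fin k) (Fin n)), 0 < k ∧ M.IsIncoherent ∧
    v = measRelEntropy (M.comp (E.tensorId (Fin k))) (M.comp (F.tensorId (Fin k)))}

/-- The maximum over incoherent measurements inside the measurement-cohering power. -/
def distinguishability (E F : Channel A) : EReal :=
  sSup (distinguishabilityValues E F)

/-- The numbers minimized in the measurement-cohering power, one for each detection-incoherent
channel `F`. -/
def measCoheringPowerValues (E : Channel A) : Set EReal :=
  {w | ∃ F : Channel A, F.IsDetectionIncoherent ∧ w = distinguishability E F}

/-- The measurement-cohering power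
`C(E) = min_F max_M D_m(M ∘ (E ⊗ id)‖M ∘ (F ⊗ id))`. -/
def measCoheringPower (E : Channel A) : EReal :=
  sInf (measCoheringPowerValues E)

/-- The values `C_m(M ∘ E)` for incoherent measurements `M` on the system itself, with an
arbitrary number of outcomes. -/
def generatedCoherenceValues (E : Channel A) : Set EReal :=
  {v | ∃ (n : ℕ) (M : Measurement A (Fin n)), M.IsIncoherent ∧ v = measCoherence (M.comp E)}

end Entropy

end MeasCoh

end

/-! Write T_i for the effects of the incoherent-basis measurement after E. An incoherent measurement
on the system and an ancilla, taken after E ⊗ id, has effects that are mixtures of the T_i ⊗ |k⟩⟨k|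
with stochastic weights (`Measurement.IsIncoherent.comp_tensorId_effect`). Joint subadditivity of
relative entropy then bounds its distinguishing power by that of the basis measurement alone, so the
inner maximum is the divergence between the basis measurement after E and after F. If F is
detection-incoherent, the second of these is itself incoherent, so the divergence is at least C_m of
the first. Equality holds for F = E ∘ Δ, which yields the dephased T_i, and dephasing gives the
closest incoherent measurement by Gibbs' inequality (`measRelEntropy_dephased_le`). The same mixing
argument without ancilla handles the maximum of C_m.

Since all second arguments are diagonal, subadditivity is needed only there
(`diagRelEntropy_sum_le`). The form ⟨P, (s R_P + L_Q)⁻¹ P⟩ is a supremum of functions linear in (P,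
Q), hence subadditive. Its integral over s in [0, r], minus log r · tr P, tends to D(P‖Q) as r → ∞.
-/

namespace MeasCoh

/-! ### Functional calculus by interpolating polynomials on finite spectra -/

section FunctionalCalculus

variable {B K : Type*} [Fintype B] [DecidableEq B] [Fintype K] [DecidableEq K]

theorem exists_polynomial_eqOn (f : ℝ → ℝ) {S : Set ℝ} (hS : S.Finite) :
    ∃ p : Polynomial ℝ, ∀ x ∈ S, p.eval x = f x :=
  ⟨Lagrange.interpolate hS.toFinset id f, fun x hx =>
    Lagrange.eval_interpolate_at_node (v := id) (s := hS.toFinset) f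
      Function.injective_id.injOn (i := x) (by simpa using hx)⟩

theorem cfc_eq_aeval {P : Matrix B B ℂ} (hP : P.IsHermitian) {f : ℝ → ℝ} {p : Polynomial ℝ}
    (hp : ∀ x ∈ spectrum ℝ P, p.eval x = f x) : cfc f P = Polynomial.aeval P p := by
  rw [← cfc_polynomial _ P hP]
  exact cfc_congr fun x hx => (hp x hx).symm

theorem finite_real_spectrum {P : Matrix B B ℂ} (hP : P.IsHermitian) : (spectrum ℝ P).Finite := by
  rw [hP.spectrum_real_eq_range_eigenvalues]
  exact Set.finite_range _

theorem cfc_diagonal (f : ℝ → ℝ) (q : B → ℝ) :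
    cfc f (Matrix.diagonal fun b => (q b : ℂ)) = Matrix.diagonal fun b => (f (q b) : ℂ) := by
  have hP : (Matrix.diagonal fun b => (q b : ℂ)).IsHermitian := by
    refine Matrix.isHermitian_diagonal_of_self_adjoint _ ?_
    ext b; simp
  -- Interpolating on the range of `q` as well avoids computing the spectrum of the diagonal matrix.
  obtain ⟨p, hp⟩ := exists_polynomial_eqOn f
    ((finite_real_spectrum hP).union (Set.finite_range q))
  rw [cfc_eq_aeval hP fun x hx => hp x (Or.inl hx)]
  have h1 : ∀ r : Polynomial ℝ, Polynomial.aeval (Matrix.diagonal fun b => (q b : ℂ)) r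
      = Matrix.diagonal fun b => ((r.eval (q b) : ℝ) : ℂ) := by
    intro r
    induction r using Polynomial.induction_on' with
    | add r s hr hs => simp [hr, hs]
    | monomial n c =>
      rw [Polynomial.aeval_monomial, Matrix.diagonal_pow, Matrix.algebraMap_eq_diagonal,
        Matrix.diagonal_mul_diagonal]
      congr 1
      ext b
      simp
  rw [h1]
  congr 1
  ext b
  rw [hp _ (Or.inr ⟨b, rfl⟩)]

open scoped Kronecker in
-- The leading factor is essential: a constant term of f gives 1 ⊗ 1 rather than 1 ⊗ e, and
-- multiplying by P ⊗ e removes the discrepancy.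
theorem mul_cfc_kronecker_idempotent {P : Matrix B B ℂ} {e : Matrix K K ℂ} (hP : P.IsHermitian)
    (he : e.IsHermitian) (hee : e * e = e) (f : ℝ → ℝ) :
    (P ⊗ₖ e) * cfc f (P ⊗ₖ e) = (P * cfc f P) ⊗ₖ e := by
  have hPe : (P ⊗ₖ e).IsHermitian := by
    rw [Matrix.IsHermitian, Matrix.conjTranspose_kronecker, hP.eq, he.eq]
  obtain ⟨p, hp⟩ := exists_polynomial_eqOn f
    ((finite_real_spectrum hP).union (finite_real_spectrum hPe))
  rw [cfc_eq_aeval hP fun x hx => hp x (Or.inl hx), cfc_eq_aeval hPe fun x hx => hp x (Or.inr hx)]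
  clear hp
  induction p using Polynomial.induction_on' with
  | add r s hr hs => simp only [map_add, mul_add, hr, hs, Matrix.add_kronecker]
  | monomial n c =>
    have h : ∀ n : ℕ, (P ⊗ₖ e) * (P ⊗ₖ e) ^ n = (P * P ^ n) ⊗ₖ e := by
      intro n
      induction n with
      | zero => simp
      | succ n ih => rw [pow_succ, ← mul_assoc, ih, ← Matrix.mul_kronecker_mul, hee, pow_succ,
          mul_assoc]
    simp only [Polynomial.aeval_monomial, ← Algebra.smul_def, mul_smul_comm, h,
      Matrix.smul_kronecker]

end FunctionalCalculus

/-! ### Relative entropy to a diagonal operator -/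

section DiagonalReference

variable {B : Type*} [Fintype B] [DecidableEq B]

/-- The weight `|⟨b|i⟩|²` of the `i`-th eigenvector of `P` on the basis vector `b`. -/
noncomputable def eigenWeight {P : Matrix B B ℂ} (hP : P.IsHermitian) (b i : B) : ℝ :=
  Complex.normSq ((hP.eigenvectorUnitary : Matrix B B ℂ) b i)

theorem eigenWeight_nonneg {P : Matrix B B ℂ} (hP : P.IsHermitian) (b i : B) :
    0 ≤ eigenWeight hP b i := Complex.normSq_nonneg _

theorem cfc_apply_entry {P : Matrix B B ℂ} (hP : P.IsHermitian) (f : ℝ → ℝ) (a b : B) :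
    cfc f P a b = ∑ i, (hP.eigenvectorUnitary : Matrix B B ℂ) a i * (f (hP.eigenvalues i) : ℂ) *
      star ((hP.eigenvectorUnitary : Matrix B B ℂ) b i) := by
  rw [hP.cfc_eq, Matrix.IsHermitian.cfc, Unitary.conjStarAlgAut_apply, Matrix.mul_apply]
  simp [Matrix.mul_diagonal, Matrix.star_apply]

theorem cfc_diag_re {P : Matrix B B ℂ} (hP : P.IsHermitian) (f : ℝ → ℝ) (b : B) :
    (cfc f P b b).re = ∑ i, eigenWeight hP b i * f (hP.eigenvalues i) := by
  rw [cfc_apply_entry hP, Complex.re_sum]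
  refine Finset.sum_congr rfl fun i _ => ?_
  rw [mul_right_comm, Complex.star_def, Complex.mul_conj, ← Complex.ofReal_mul, Complex.ofReal_re]
  rfl

theorem diag_re {P : Matrix B B ℂ} (hP : P.IsHermitian) (b : B) :
    (P b b).re = ∑ i, eigenWeight hP b i * hP.eigenvalues i := by
  have h := cfc_diag_re hP id b
  rwa [cfc_id ℝ P hP.isSelfAdjoint] at h

/-- The real number `tr P (log P - log Q)` for `Q` diagonal with entries `q`. -/
noncomputable def diagRelEntropy (P : Matrix B B ℂ) (q : B → ℝ) : ℝ :=
  (P * cfc Real.log P).trace.re - ∑ b, (P b b).re * Real.log (q b)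

theorem trace_mul_log_sub_log (P : Matrix B B ℂ) (q : B → ℝ) :
    (P * (cfc Real.log P - cfc Real.log (Matrix.diagonal fun b => (q b : ℂ)))).trace.re =
      diagRelEntropy P q := by
  rw [cfc_diagonal, mul_sub, Matrix.trace_sub, Complex.sub_re, diagRelEntropy]
  congr 1
  simp [Matrix.trace, Matrix.mul_diagonal]

/-- Expanding P in its eigenbasis and Q in the standard basis makes the entropy a classical double
sum, although P and Q need not commute. -/
theorem diagRelEntropy_eq_sum {P : Matrix B B ℂ} (hP : P.IsHermitian) (q : B → ℝ) :
    diagRelEntropy P q = ∑ b, ∑ i, eigenWeight hP b i * hP.eigenvalues i *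
      (Real.log (hP.eigenvalues i) - Real.log (q b)) := by
  have h1 : P * cfc Real.log P = cfc (fun x => x * Real.log x) P := by
    have hfin := fun f : ℝ → ℝ => (finite_real_spectrum hP).continuousOn f
    rw [cfc_mul (fun x => x) Real.log P (hfin _) (hfin _), cfc_id' ℝ P hP.isSelfAdjoint]
  rw [diagRelEntropy, h1, Matrix.trace, Complex.re_sum, ← Finset.sum_sub_distrib]
  refine Finset.sum_congr rfl fun b _ => ?_
  rw [Matrix.diag_apply, cfc_diag_re hP, diag_re hP, Finset.sum_mul, ← Finset.sum_sub_distrib]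
  exact Finset.sum_congr rfl fun i _ => by ring

/-- A zero diagonal entry of a positive semidefinite matrix kills its whole column, so the support
condition can be read off the diagonals. -/
theorem mulVec_diagonal_support_iff {P : Matrix B B ℂ} (hP : P.PosSemidef) (q : B → ℝ) :
    (∀ v : B → ℂ, (Matrix.diagonal fun b => (q b : ℂ)).mulVec v = 0 → P.mulVec v = 0) ↔
      ∀ b, q b = 0 → P b b = 0 := by
  constructor
  · intro h b hb
    have h1 := h (Pi.single b 1) (by
      ext a
      by_cases hab : a = b
      · subst hab; simp [Matrix.mulVec_diagonal, hb]
      · simp [Matrix.mulVec_diagonal, hab])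
    simpa using congrFun h1 b
  · intro h v hv
    have hcol : ∀ b, q b = 0 → ∀ a, P a b = 0 := by
      intro b hb a
      have h1 := (hP.dotProduct_mulVec_zero_iff (Pi.single b 1)).mp (by simp [h b hb])
      simpa using congrFun h1 a
    ext a
    refine Finset.sum_eq_zero fun b _ => ?_
    have hb : (q b : ℂ) * v b = 0 := by simpa [Matrix.mulVec_diagonal] using congrFun hv b
    rcases mul_eq_zero.mp hb with hb | hb
    · exact mul_eq_zero_of_left (hcol b (by exact_mod_cast hb) a) _
    · rw [hb, mul_zero]

/-- These are nonnegative terms with sum P b b. Their vanishing makes the value of log at a zero of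
q irrelevant. -/
theorem eigenWeight_mul_eigenvalues_eq_zero {P : Matrix B B ℂ} (hP : P.PosSemidef) {b : B}
    (hb : P b b = 0) (i : B) : eigenWeight hP.1 b i * hP.1.eigenvalues i = 0 := by
  have h := diag_re hP.1 b
  rw [hb, Complex.zero_re, eq_comm, Finset.sum_eq_zero_iff_of_nonneg] at h
  · exact h i (Finset.mem_univ i)
  · exact fun i _ => mul_nonneg (eigenWeight_nonneg _ _ _) (hP.eigenvalues_nonneg i)

theorem relEntropy_diagonal {P : Matrix B B ℂ} (hP : P.PosSemidef) {q : B → ℝ}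
    (h : ∀ b, q b = 0 → P b b = 0) :
    relEntropy P (Matrix.diagonal fun b => (q b : ℂ)) = (diagRelEntropy P q : ℝ) := by
  rw [relEntropy, if_pos ((mulVec_diagonal_support_iff hP q).mpr h), trace_mul_log_sub_log]

theorem relEntropy_diagonal_eq_top {P : Matrix B B ℂ} (hP : P.PosSemidef) {q : B → ℝ}
    (h : ¬ ∀ b, q b = 0 → P b b = 0) :
    relEntropy P (Matrix.diagonal fun b => (q b : ℂ)) = ⊤ := by
  rw [relEntropy, if_neg fun h' => h ((mulVec_diagonal_support_iff hP q).mp h')]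

theorem relEntropy_ne_bot (P Q : Matrix B B ℂ) : relEntropy P Q ≠ ⊥ := by
  unfold relEntropy
  split_ifs
  · exact EReal.coe_ne_bot _
  · exact top_ne_bot

end DiagonalReference

/-! ### Joint subadditivity through resolvents -/

section JointSubadditivity

variable {B J : Type*} [Fintype B] [Fintype J]

open scoped Matrix

/-- The function of `X`, affine in `(P, q)`, whose supremum over `X` is `resolventForm`. -/
noncomputable def variationalForm (s : ℝ) (P : Matrix B B ℂ) (q : B → ℝ) (X : Matrix B B ℂ) : ℝ :=
  2 * (Xᴴ * P).trace.re - s * (X * P * Xᴴ).trace.re -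
    ∑ b, q b * ((X * Xᴴ) b b).re

theorem variationalForm_sum (s : ℝ) (c : J → ℝ) (P : J → Matrix B B ℂ) (q : J → B → ℝ)
    (X : Matrix B B ℂ) :
    variationalForm s (∑ j, (c j : ℂ) • P j) (fun b => ∑ j, c j * q j b) X =
      ∑ j, c j * variationalForm s (P j) (q j) X := by
  simp only [variationalForm, Matrix.mul_smul, Matrix.smul_mul,
    Matrix.trace_sum, Matrix.trace_smul, Complex.re_sum, smul_eq_mul, Complex.re_ofReal_mul,
    mul_sub, Finset.sum_sub_distrib, Finset.mul_sum, Finset.sum_mul]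
  rw [Finset.sum_comm (s := (Finset.univ : Finset B))]
  simp only [mul_left_comm, mul_assoc]

variable [DecidableEq B]

/-- The form `⟨P, (s R_P + L_Q)⁻¹ P⟩` with `Q` diagonal with entries `q`, where `R_P` and `L_Q`
are multiplication by `P` on the right and by `Q` on the left. -/
noncomputable def resolventForm {P : Matrix B B ℂ} (hP : P.IsHermitian) (q : B → ℝ) (s : ℝ) : ℝ :=
  ∑ b, ∑ i, eigenWeight hP b i * hP.eigenvalues i * hP.eigenvalues i /
    (s * hP.eigenvalues i + q b)

/-- In the coordinates X = Y Uᴴ, with U diagonalizing P, the form splits into one scalar quadratic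
per entry of Y. -/
theorem variationalForm_eq_sum {P : Matrix B B ℂ} (hP : P.IsHermitian) (q : B → ℝ) (s : ℝ)
    (Y : Matrix B B ℂ) :
    variationalForm s P q (Y * (hP.eigenvectorUnitary : Matrix B B ℂ)ᴴ) =
      ∑ b, ∑ i, (2 * hP.eigenvalues i *
        (star (Y b i) * (hP.eigenvectorUnitary : Matrix B B ℂ) b i).re -
          (s * hP.eigenvalues i + q b) * Complex.normSq (Y b i)) := by
  obtain ⟨U, hU⟩ : ∃ U : Matrix B B ℂ, U = hP.eigenvectorUnitary := ⟨_, rfl⟩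
  set D : Matrix B B ℂ := Matrix.diagonal fun i => (hP.eigenvalues i : ℂ) with hD
  have hUU : Uᴴ * U = 1 := hU ▸ Unitary.coe_star_mul_self hP.eigenvectorUnitary
  have hPU : P = U * D * Uᴴ := by
    have := hP.spectral_theorem
    rw [Unitary.conjStarAlgAut_apply] at this
    rw [hU]
    exact this
  rw [← hU]
  have h1 : ((Y * Uᴴ)ᴴ * P).trace = (Yᴴ * U * D).trace := by
    rw [hPU, Matrix.conjTranspose_mul, Matrix.conjTranspose_conjTranspose, Matrix.mul_assoc,
      Matrix.trace_mul_comm]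
    simp only [Matrix.mul_assoc]
    rw [hUU, Matrix.mul_one]
  have h2 : Y * Uᴴ * P * (Y * Uᴴ)ᴴ = Y * D * Yᴴ := by
    rw [hPU, Matrix.conjTranspose_mul, Matrix.conjTranspose_conjTranspose]
    have : Y * Uᴴ * (U * D * Uᴴ) * (U * Yᴴ) = Y * (Uᴴ * U) * D * (Uᴴ * U) * Yᴴ := by
      simp only [Matrix.mul_assoc]
    rw [this, hUU, Matrix.mul_one, Matrix.mul_one]
  have h3 : Y * Uᴴ * (Y * Uᴴ)ᴴ = Y * Yᴴ := by
    rw [Matrix.conjTranspose_mul, Matrix.conjTranspose_conjTranspose]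
    have : Y * Uᴴ * (U * Yᴴ) = Y * (Uᴴ * U) * Yᴴ := by simp only [Matrix.mul_assoc]
    rw [this, hUU, Matrix.mul_one]
  have e1 : (Yᴴ * U * D).trace.re =
      ∑ b, ∑ i, hP.eigenvalues i * (star (Y b i) * U b i).re := by
    rw [Finset.sum_comm, Matrix.trace, Complex.re_sum]
    refine Finset.sum_congr rfl fun i _ => ?_
    rw [Matrix.diag_apply, hD, Matrix.mul_diagonal, mul_comm, Complex.re_ofReal_mul,
      Matrix.mul_apply, Complex.re_sum, Finset.mul_sum]
    rfl
  have e2 : (Y * D * Yᴴ).trace.re =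
      ∑ b, ∑ i, hP.eigenvalues i * Complex.normSq (Y b i) := by
    rw [Matrix.trace, Complex.re_sum]
    refine Finset.sum_congr rfl fun b _ => ?_
    rw [Matrix.diag_apply, Matrix.mul_apply, Complex.re_sum]
    refine Finset.sum_congr rfl fun i _ => ?_
    rw [hD, Matrix.mul_diagonal, Matrix.conjTranspose_apply, mul_right_comm, Complex.star_def,
      Complex.mul_conj, ← Complex.ofReal_mul, Complex.ofReal_re, mul_comm]
  have e3 : ∀ b, ((Y * Yᴴ) b b).re = ∑ i, Complex.normSq (Y b i) := by
    intro b
    rw [Matrix.mul_apply, Complex.re_sum]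
    refine Finset.sum_congr rfl fun i _ => ?_
    rw [Matrix.conjTranspose_apply, Complex.star_def, Complex.mul_conj, Complex.ofReal_re]
  rw [variationalForm, h1, h2, h3, e1, e2]
  simp only [e3, Finset.mul_sum, ← Finset.sum_sub_distrib]
  refine Finset.sum_congr rfl fun b _ => Finset.sum_congr rfl fun i _ => ?_
  ring

/-- Complete the square in y. When r = 0 both sides are 0, by the convention for division by zero.
-/
theorem two_mul_re_sub_le {p r : ℝ} (hr : 0 ≤ r) (hpr : r = 0 → p = 0) (y u : ℂ) :
    2 * p * (star y * u).re - r * Complex.normSq y ≤ Complex.normSq u * p * p / r := by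
  rcases hr.eq_or_lt with h | h
  · simp [← h, hpr h.symm]
  · rw [le_div_iff₀ h]
    simp only [Complex.normSq_apply, Complex.star_def, Complex.mul_re, Complex.conj_re,
      Complex.conj_im]
    nlinarith [sq_nonneg (r * y.re - p * u.re), sq_nonneg (r * y.im - p * u.im)]

theorem two_mul_re_sub_eq {p r : ℝ} (hpr : r = 0 → p = 0) (u : ℂ) :
    2 * p * (star (((p / r : ℝ) : ℂ) * u) * u).re -
      r * Complex.normSq (((p / r : ℝ) : ℂ) * u) = Complex.normSq u * p * p / r := by
  by_cases h : r = 0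
  · simp [h, hpr h]
  · have h1 : (star (((p / r : ℝ) : ℂ) * u) * u).re = p / r * Complex.normSq u := by
      simp only [star_mul', Complex.star_def, Complex.conj_ofReal, mul_assoc]
      rw [← Complex.normSq_eq_conj_mul_self, ← Complex.ofReal_mul,
        Complex.ofReal_re]
    rw [h1, Complex.normSq_mul, Complex.normSq_ofReal]
    field_simp
    ring

theorem variationalForm_le_resolventForm {P : Matrix B B ℂ} (hP : P.PosSemidef) {q : B → ℝ}
    (hq : ∀ b, 0 ≤ q b) {s : ℝ} (hs : 0 < s) (X : Matrix B B ℂ) :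
    variationalForm s P q X ≤ resolventForm hP.1 q s := by
  have hX : X = X * (hP.1.eigenvectorUnitary : Matrix B B ℂ) *
      (hP.1.eigenvectorUnitary : Matrix B B ℂ)ᴴ := by
    have h : (hP.1.eigenvectorUnitary : Matrix B B ℂ) *
      (hP.1.eigenvectorUnitary : Matrix B B ℂ)ᴴ = 1 :=
      Unitary.coe_mul_star_self hP.1.eigenvectorUnitary
    rw [Matrix.mul_assoc, h, Matrix.mul_one]
  rw [hX, variationalForm_eq_sum]
  refine Finset.sum_le_sum fun b _ => Finset.sum_le_sum fun i _ => ?_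
  have h0 := hP.eigenvalues_nonneg i
  refine two_mul_re_sub_le (by have := hq b; positivity) (fun h => ?_) _ _
  nlinarith [hq b, mul_nonneg hs.le h0]

theorem exists_variationalForm_eq_resolventForm {P : Matrix B B ℂ} (hP : P.PosSemidef)
    {q : B → ℝ} (hq : ∀ b, 0 ≤ q b) {s : ℝ} (hs : 0 < s) :
    ∃ X, variationalForm s P q X = resolventForm hP.1 q s := by
  refine ⟨(Matrix.of fun b i => ((hP.1.eigenvalues i / (s * hP.1.eigenvalues i + q b) : ℝ) : ℂ) *
    (hP.1.eigenvectorUnitary : Matrix B B ℂ) b i) *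
      (hP.1.eigenvectorUnitary : Matrix B B ℂ)ᴴ, ?_⟩
  rw [variationalForm_eq_sum]
  refine Finset.sum_congr rfl fun b _ => Finset.sum_congr rfl fun i _ => ?_
  refine two_mul_re_sub_eq (fun h => ?_) _
  have h0 := hP.eigenvalues_nonneg i
  nlinarith [hq b, mul_nonneg hs.le h0]

/-- The X that is optimal for the sum is merely admissible for each summand. The weights need not
sum to 1, because the variational form is linear in (P, q). -/
theorem resolventForm_sum_le {c : J → ℝ} (hc : ∀ j, 0 ≤ c j) {P : J → Matrix B B ℂ}
    (hP : ∀ j, (P j).PosSemidef) {q : J → B → ℝ} (hq : ∀ j b, 0 ≤ q j b)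
    (hS : (∑ j, (c j : ℂ) • P j).PosSemidef) {s : ℝ} (hs : 0 < s) :
    resolventForm hS.1 (fun b => ∑ j, c j * q j b) s ≤
      ∑ j, c j * resolventForm (hP j).1 (q j) s := by
  obtain ⟨X, hX⟩ := exists_variationalForm_eq_resolventForm hS
    (fun b => Finset.sum_nonneg fun j _ => mul_nonneg (hc j) (hq j b)) hs
  rw [← hX, variationalForm_sum]
  exact Finset.sum_le_sum fun j _ =>
    mul_le_mul_of_nonneg_left (variationalForm_le_resolventForm (hP j) (hq j) hs X) (hc j)

/-- The integral of `resolventForm hP q` over `[0, r]`. -/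
noncomputable def resolventIntegral {P : Matrix B B ℂ} (hP : P.IsHermitian) (q : B → ℝ)
    (r : ℝ) : ℝ :=
  ∑ b, ∑ i, eigenWeight hP b i * hP.eigenvalues i *
    (Real.log (r * hP.eigenvalues i + q b) - Real.log (q b))

theorem hasDerivAt_resolventIntegral {P : Matrix B B ℂ} (hP : P.PosSemidef) {q : B → ℝ}
    (hq : ∀ b, 0 ≤ q b) (hPq : ∀ b, q b = 0 → P b b = 0) {r : ℝ} (hr : 0 ≤ r) :
    HasDerivAt (resolventIntegral hP.1 q) (resolventForm hP.1 q r) r := by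
  refine HasDerivAt.fun_sum fun b _ => HasDerivAt.fun_sum fun i _ => ?_
  -- If q b = 0 the coefficient vanishes; otherwise the argument of log is positive, even at r = 0.
  by_cases h : q b = 0
  · simp only [eigenWeight_mul_eigenvalues_eq_zero hP (hPq b h) i, zero_mul, zero_div]
    exact hasDerivAt_const _ _
  · have h0 : 0 < r * hP.1.eigenvalues i + q b :=
      add_pos_of_nonneg_of_pos (mul_nonneg hr (hP.eigenvalues_nonneg i))
        (lt_of_le_of_ne (hq b) (Ne.symm h))
    have h1 := (((((hasDerivAt_id r).mul_const (hP.1.eigenvalues i)).add_const (q b)).log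
      h0.ne').sub_const (Real.log (q b))).const_mul
        (eigenWeight hP.1 b i * hP.1.eigenvalues i)
    rw [one_mul, ← mul_div_assoc] at h1
    exact h1

theorem resolventIntegral_zero {P : Matrix B B ℂ} (hP : P.IsHermitian) (q : B → ℝ) :
    resolventIntegral hP q 0 = 0 := by
  simp [resolventIntegral]

/-- The difference of the two sides is 0 at r = 0 and has nonnegative derivative for r > 0. -/
theorem resolventIntegral_sum_le {c : J → ℝ} (hc : ∀ j, 0 ≤ c j) {P : J → Matrix B B ℂ}
    (hP : ∀ j, (P j).PosSemidef) {q : J → B → ℝ} (hq : ∀ j b, 0 ≤ q j b)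
    (hPq : ∀ j b, q j b = 0 → P j b b = 0) (hS : (∑ j, (c j : ℂ) • P j).PosSemidef)
    (hSq : ∀ b, ∑ j, c j * q j b = 0 → (∑ j, (c j : ℂ) • P j) b b = 0) {r : ℝ} (hr : 0 ≤ r) :
    resolventIntegral hS.1 (fun b => ∑ j, c j * q j b) r ≤
      ∑ j, c j * resolventIntegral (hP j).1 (q j) r := by
  have hd : ∀ t, 0 ≤ t → HasDerivAt (fun t => ∑ j, c j * resolventIntegral (hP j).1 (q j) t -
      resolventIntegral hS.1 (fun b => ∑ j, c j * q j b) t)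
      (∑ j, c j * resolventForm (hP j).1 (q j) t -
        resolventForm hS.1 (fun b => ∑ j, c j * q j b) t) t := fun t ht =>
    (HasDerivAt.fun_sum fun j _ =>
      (hasDerivAt_resolventIntegral (hP j) (hq j) (hPq j) ht).const_mul (c j)).sub
      (hasDerivAt_resolventIntegral hS
        (fun b => Finset.sum_nonneg fun j _ => mul_nonneg (hc j) (hq j b)) hSq ht)
  have hmono := monotoneOn_of_deriv_nonneg (convex_Ici (0 : ℝ))
    (fun t ht => (hd t ht).continuousAt.continuousWithinAt)
    (fun t ht => (hd t (interior_subset ht)).differentiableAt.differentiableWithinAt)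
    (fun t ht => by
      rw [(hd t (interior_subset ht)).deriv, sub_nonneg]
      rw [interior_Ici] at ht
      exact resolventForm_sum_le hc hP hq hS ht)
  have h := hmono Set.self_mem_Ici hr hr
  simp only [resolventIntegral_zero, mul_zero, Finset.sum_const_zero, sub_zero] at h
  exact sub_nonneg.mp h

theorem trace_re_eq_sum {P : Matrix B B ℂ} (hP : P.IsHermitian) :
    P.trace.re = ∑ b, ∑ i, eigenWeight hP b i * hP.eigenvalues i := by
  rw [Matrix.trace, Complex.re_sum]
  exact Finset.sum_congr rfl fun b _ => diag_re hP b

open Filter Topology in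
-- For λ > 0, log (rλ + q) - log r tends to log λ; terms with λ = 0 vanish. The coefficients of log
-- r add up to tr P.
theorem tendsto_resolventIntegral {P : Matrix B B ℂ} (hP : P.PosSemidef) (q : B → ℝ) :
    Tendsto (fun r => resolventIntegral hP.1 q r - Real.log r * P.trace.re) atTop
      (𝓝 (diagRelEntropy P q)) := by
  rw [diagRelEntropy_eq_sum hP.1, trace_re_eq_sum hP.1]
  simp only [resolventIntegral, Finset.mul_sum, ← Finset.sum_sub_distrib]
  refine tendsto_finsetSum _ fun b _ => tendsto_finsetSum _ fun i _ => ?_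
  rcases (hP.eigenvalues_nonneg i).eq_or_lt with h | h
  · simp [← h]
  · have h1 : Tendsto (fun r => hP.1.eigenvalues i + q b / r) atTop
        (𝓝 (hP.1.eigenvalues i + 0)) :=
      tendsto_const_nhds.add (tendsto_const_nhds.div_atTop tendsto_id)
    rw [add_zero] at h1
    have h2 := ((h1.log h.ne').sub_const (Real.log (q b))).const_mul
      (eigenWeight hP.1 b i * hP.1.eigenvalues i)
    refine h2.congr' ?_
    filter_upwards [eventually_gt_atTop 0, h1.eventually_ne h.ne'] with r hr hne
    have h3 : r * hP.1.eigenvalues i + q b = r * (hP.1.eigenvalues i + q b / r) := by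
      field_simp
    rw [h3, Real.log_mul hr.ne' hne]
    ring

/-- Joint subadditivity of the relative entropy for diagonal second arguments. -/
theorem diagRelEntropy_sum_le {c : J → ℝ} (hc : ∀ j, 0 ≤ c j) {P : J → Matrix B B ℂ}
    (hP : ∀ j, (P j).PosSemidef) {q : J → B → ℝ} (hq : ∀ j b, 0 ≤ q j b)
    (hPq : ∀ j b, q j b = 0 → P j b b = 0) (hS : (∑ j, (c j : ℂ) • P j).PosSemidef)
    (hSq : ∀ b, ∑ j, c j * q j b = 0 → (∑ j, (c j : ℂ) • P j) b b = 0) :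
    diagRelEntropy (∑ j, (c j : ℂ) • P j) (fun b => ∑ j, c j * q j b) ≤
      ∑ j, c j * diagRelEntropy (P j) (q j) := by
  refine le_of_tendsto_of_tendsto (tendsto_resolventIntegral hS _)
    (tendsto_finsetSum _ fun j _ => (tendsto_resolventIntegral (hP j) (q j)).const_mul (c j)) ?_
  filter_upwards [Filter.eventually_ge_atTop 0] with r hr
  have h := resolventIntegral_sum_le hc hP hq hPq hS hSq hr
  -- The trace is linear, so the log r corrections on the two sides agree.
  have ht : (∑ j, (c j : ℂ) • P j).trace.re = ∑ j, c j * (P j).trace.re := by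
    simp [Matrix.trace_sum, Matrix.trace_smul]
  simp only [mul_sub, Finset.sum_sub_distrib]
  rw [ht, Finset.mul_sum]
  simp only [mul_left_comm (Real.log r)]
  linarith

end JointSubadditivity

/-! ### Diagonals of positive semidefinite matrices -/

section PosSemidefDiag

variable {B J K : Type*} [Fintype J] [Fintype K] [DecidableEq K]

theorem posSemidef_diag_eq_re {P : Matrix B B ℂ} (hP : P.PosSemidef) (b : B) :
    ((P b b).re : ℂ) = P b b :=
  (Complex.eq_re_of_ofReal_le (r := 0) (by simpa using hP.diag_nonneg (i := b))).symm

theorem posSemidef_diag_re_nonneg {P : Matrix B B ℂ} (hP : P.PosSemidef) (b : B) :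
    0 ≤ (P b b).re :=
  (Complex.nonneg_iff.mp (hP.diag_nonneg (i := b))).1

theorem posSemidef_diag_eq_zero_iff {P : Matrix B B ℂ} (hP : P.PosSemidef) (b : B) :
    (P b b).re = 0 ↔ P b b = 0 := by
  rw [← posSemidef_diag_eq_re hP b, Complex.ofReal_re, Complex.ofReal_eq_zero]

open scoped Kronecker in
theorem posSemidef_kronecker_single [Fintype B] {P : Matrix B B ℂ} (hP : P.PosSemidef) (k : K) :
    (P ⊗ₖ Matrix.single k k (1 : ℂ)).PosSemidef :=
  hP.kronecker ((incoherentBasisMeasurement K).posSemidef k)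

theorem posSemidef_sum_ofReal_smul {c : J → ℝ} (hc : ∀ j, 0 ≤ c j) {P : J → Matrix B B ℂ}
    (hP : ∀ j, (P j).PosSemidef) : (∑ j, (c j : ℂ) • P j).PosSemidef :=
  Matrix.posSemidef_sum _ fun j _ => (hP j).smul (by simpa using hc j)

theorem sum_ofReal_smul_diag_eq_zero {c : J → ℝ} (hc : ∀ j, 0 ≤ c j) {P : J → Matrix B B ℂ}
    {q : J → B → ℝ} (hq : ∀ j b, 0 ≤ q j b) (hPq : ∀ j b, q j b = 0 → P j b b = 0) (b : B)
    (h : ∑ j, c j * q j b = 0) : (∑ j, (c j : ℂ) • P j) b b = 0 := by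
  rw [Matrix.sum_apply]
  refine Finset.sum_eq_zero fun j hj => ?_
  rw [Finset.sum_eq_zero_iff_of_nonneg fun j _ => mul_nonneg (hc j) (hq j b)] at h
  rcases mul_eq_zero.mp (h j hj) with h | h
  · simp [h]
  · simp [hPq j b h]

end PosSemidefDiag

/-! ### Incoherent measurements and the closest one -/

section DiagonalMeasurements

variable {B X K : Type*} [Fintype B] [DecidableEq B] [Fintype X] [Fintype K] [DecidableEq K]

theorem dephase_apply (P : Matrix B B ℂ) : dephase B P = Matrix.diagonal P.diag := rfl

theorem dephase_eq_diagonal {P : Matrix B B ℂ} (hP : P.PosSemidef) :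
    dephase B P = Matrix.diagonal fun b => ((P b b).re : ℂ) := by
  simp only [posSemidef_diag_eq_re hP]
  rfl

theorem relEntropy_dephase (P Q : Matrix B B ℂ) (hP : P.PosSemidef) (hQ : Q.PosSemidef)
    (h : ∀ b, Q b b = 0 → P b b = 0) :
    relEntropy P (dephase B Q) = (diagRelEntropy P fun b => (Q b b).re : ℝ) := by
  rw [dephase_eq_diagonal hQ, relEntropy_diagonal hP]
  exact fun b hb => h b ((posSemidef_diag_eq_zero_iff hQ b).mp hb)

theorem relEntropy_dephase_eq_top (P Q : Matrix B B ℂ) (hP : P.PosSemidef) (hQ : Q.PosSemidef)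
    (h : ¬ ∀ b, Q b b = 0 → P b b = 0) : relEntropy P (dephase B Q) = ⊤ := by
  rw [dephase_eq_diagonal hQ, relEntropy_diagonal_eq_top hP]
  exact fun h' => h fun b hb => h' b ((posSemidef_diag_eq_zero_iff hQ b).mpr hb)

theorem sum_coe_ereal (f : X → ℝ) : ∑ x, (f x : EReal) = ((∑ x, f x : ℝ) : EReal) :=
  (map_sum (⟨⟨fun r : ℝ => (r : EReal), EReal.coe_zero⟩, EReal.coe_add⟩ : ℝ →+ EReal)
    f Finset.univ).symm

theorem sum_ereal_eq_top {f : X → EReal} (hf : ∀ x, f x ≠ ⊥) {x : X} (hx : f x = ⊤) :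
    ∑ x, f x = ⊤ := by
  classical
  rw [← Finset.add_sum_erase _ _ (Finset.mem_univ x), hx, EReal.top_add_of_ne_bot]
  exact Finset.sum_induction _ (· ≠ ⊥) (fun a b ha hb => EReal.add_ne_bot_iff.mpr ⟨ha, hb⟩)
    EReal.zero_ne_bot fun x _ => hf x

theorem measRelEntropy_eq_coe {M F : Measurement B X} (hF : F.IsIncoherent)
    (h : ∀ x b, F.effect x b b = 0 → M.effect x b b = 0) :
    measRelEntropy M F = (((Fintype.card B : ℝ)⁻¹ *
      ∑ x, diagRelEntropy (M.effect x) fun b => (F.effect x b b).re : ℝ) : EReal) := by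
  rw [measRelEntropy, EReal.coe_mul, ← sum_coe_ereal]
  congr 1
  refine Finset.sum_congr rfl fun x _ => ?_
  rw [← relEntropy_dephase _ _ (M.posSemidef x) (F.posSemidef x) (h x), hF x]

theorem measRelEntropy_eq_top {M F : Measurement B X} (hF : F.IsIncoherent)
    (h : ¬ ∀ x b, F.effect x b b = 0 → M.effect x b b = 0) : measRelEntropy M F = ⊤ := by
  push Not at h
  obtain ⟨x, b, h1, h2⟩ := h
  -- The prefactor must be strictly positive, since `0 * ⊤ = 0` in `EReal`.
  have : Nonempty B := ⟨b⟩
  rw [measRelEntropy, sum_ereal_eq_top (fun x => relEntropy_ne_bot _ _) (x := x),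
    EReal.coe_mul_top_of_pos]
  · positivity
  · rw [← hF x]
    exact relEntropy_dephase_eq_top _ _ (M.posSemidef x) (F.posSemidef x)
      fun h => h2 (h b h1)

theorem dephase_posSemidef {P : Matrix B B ℂ} (hP : P.PosSemidef) : (dephase B P).PosSemidef :=
  Matrix.PosSemidef.diagonal fun b => hP.diag_nonneg (i := b)

/-- The measurement with dephased POVM elements. -/
def Measurement.dephased (M : Measurement B X) : Measurement B X where
  effect x := dephase B (M.effect x)
  posSemidef x := dephase_posSemidef (M.posSemidef x)
  sum_effect := by
    rw [← map_sum, M.sum_effect, dephase_apply, Matrix.diag_one]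
    exact Matrix.diagonal_one

theorem Measurement.dephased_effect (M : Measurement B X) (x : X) :
    M.dephased.effect x = dephase B (M.effect x) := rfl

theorem Measurement.dephased_isIncoherent (M : Measurement B X) : M.dephased.IsIncoherent := by
  intro x
  exact congrArg Matrix.diagonal (Matrix.diag_diagonal (M.effect x).diag)

theorem Measurement.dephased_diag (M : Measurement B X) (x : X) (b : B) :
    M.dephased.effect x b b = M.effect x b b :=
  Matrix.diagonal_apply_eq _ b

theorem Measurement.dephased_support (M : Measurement B X) (x : X) (b : B)
    (h : M.dephased.effect x b b = 0) : M.effect x b b = 0 := by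
  rwa [M.dephased_diag] at h

theorem Measurement.sum_diag_re (M : Measurement B X) (b : B) :
    ∑ x, (M.effect x b b).re = 1 := by
  rw [← Complex.re_sum, ← Matrix.sum_apply, M.sum_effect, Matrix.one_apply_eq, Complex.one_re]

/-- This is log t ≤ t - 1 at t = q / p, the pointwise form of Gibbs' inequality. -/
theorem sub_le_mul_log_sub_log {p q : ℝ} (hp : 0 ≤ p) (hq : 0 ≤ q) (h : q = 0 → p = 0) :
    p - q ≤ p * Real.log p - p * Real.log q := by
  rcases hp.eq_or_lt with hp | hp
  · simpa [← hp] using hq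
  · have hq : 0 < q := lt_of_le_of_ne hq fun h' => hp.ne' (h h'.symm)
    have h1 := Real.log_le_sub_one_of_pos (div_pos hq hp)
    rw [Real.log_div hq.ne' hp.ne'] at h1
    have h2 := mul_le_mul_of_nonneg_left h1 hp.le
    have h3 : p * (q / p - 1) = q - p := by field_simp
    linarith

/-- The incoherent measurement closest to `M` is the dephased `M`. -/
theorem measRelEntropy_dephased_le (M : Measurement B X) {F : Measurement B X}
    (hF : F.IsIncoherent) : measRelEntropy M M.dephased ≤ measRelEntropy M F := by
  by_cases h : ∀ x b, F.effect x b b = 0 → M.effect x b b = 0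
  · rw [measRelEntropy_eq_coe hF h, measRelEntropy_eq_coe M.dephased_isIncoherent
      M.dephased_support, EReal.coe_le_coe_iff]
    refine mul_le_mul_of_nonneg_left ?_ (by positivity)
    rw [← sub_nonneg, ← Finset.sum_sub_distrib]
    -- The terms P log P cancel in the difference, leaving a classical comparison of the diagonals.
    -- Summed over x, the left side is 0, as both diagonals are normalized at each b.
    have h1 : ∀ x, ∑ b, ((M.effect x b b).re - (F.effect x b b).re) ≤
        diagRelEntropy (M.effect x) (fun b => (F.effect x b b).re) -
          diagRelEntropy (M.effect x) (fun b => (M.dephased.effect x b b).re) := by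
      intro x
      simp only [diagRelEntropy, M.dephased_diag]
      rw [sub_sub_sub_cancel_left, ← Finset.sum_sub_distrib]
      refine Finset.sum_le_sum fun b _ => ?_
      refine sub_le_mul_log_sub_log (posSemidef_diag_re_nonneg (M.posSemidef x) b)
        (posSemidef_diag_re_nonneg (F.posSemidef x) b) fun hb => ?_
      rw [h x b ((posSemidef_diag_eq_zero_iff (F.posSemidef x) b).mp hb), Complex.zero_re]
    refine le_trans (le_of_eq ?_) (Finset.sum_le_sum fun x _ => h1 x)
    rw [Finset.sum_comm]
    simp [Finset.sum_sub_distrib, Measurement.sum_diag_re]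
  · rw [measRelEntropy_eq_top hF h]
    exact le_top

theorem isLeast_measCoherenceValues (M : Measurement B X) :
    IsLeast (measCoherenceValues M) (measRelEntropy M M.dephased) :=
  ⟨⟨_, M.dephased_isIncoherent, rfl⟩, by
    rintro _ ⟨F, hF, rfl⟩
    exact measRelEntropy_dephased_le M hF⟩

theorem measCoherence_eq (M : Measurement B X) :
    measCoherence M = measRelEntropy M M.dephased :=
  (isLeast_measCoherenceValues M).isGLB.sInf_eq

open scoped Kronecker in
-- Outside the block k the second argument is 0, but so is the diagonal of the first, so only that
-- block contributes.
theorem diagRelEntropy_kronecker_single {P : Matrix B B ℂ} (hP : P.IsHermitian) (q : B → ℝ)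
    (k : K) : diagRelEntropy (P ⊗ₖ Matrix.single k k 1)
      (fun p => q p.1 * if p.2 = k then 1 else 0) = diagRelEntropy P q := by
  have he : (Matrix.single k k (1 : ℂ)).IsHermitian := by
    simp [Matrix.IsHermitian, Matrix.conjTranspose_single]
  rw [diagRelEntropy, mul_cfc_kronecker_idempotent hP he (by simp), Matrix.trace_kronecker,
    Matrix.trace_single_eq_same, mul_one, diagRelEntropy, Fintype.sum_prod_type]
  congr 1
  refine Finset.sum_congr rfl fun b _ => ?_
  rw [Finset.sum_eq_single k]
  · simp
  · intro l _ hl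
    simp [hl.symm]
  · simp

end DiagonalMeasurements

/-! ### Stochastic coarse graining -/

section Mixtures

variable {B X J : Type*} [Fintype B] [DecidableEq B] [Fintype X] [Fintype J]

/-- Coarse graining positive operators by a stochastic matrix `m` does not increase the total
relative entropy. -/
theorem sum_diagRelEntropy_le {m : X → J → ℝ} (hm : ∀ x j, 0 ≤ m x j)
    (hm1 : ∀ j, ∑ x, m x j = 1) {P : J → Matrix B B ℂ} (hP : ∀ j, (P j).PosSemidef)
    {q : J → B → ℝ} (hq : ∀ j b, 0 ≤ q j b) (hPq : ∀ j b, q j b = 0 → P j b b = 0) :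
    ∑ x, diagRelEntropy (∑ j, (m x j : ℂ) • P j) (fun b => ∑ j, m x j * q j b) ≤
      ∑ j, diagRelEntropy (P j) (q j) := by
  calc _ ≤ ∑ x, ∑ j, m x j * diagRelEntropy (P j) (q j) :=
        Finset.sum_le_sum fun x _ => diagRelEntropy_sum_le (hm x) hP hq hPq
          (posSemidef_sum_ofReal_smul (hm x) hP) (sum_ofReal_smul_diag_eq_zero (hm x) hq hPq)
    _ = _ := by
      rw [Finset.sum_comm]
      simp only [← Finset.sum_mul, hm1, one_mul]

end Mixtures

/-! ### Dephasing, detection-incoherent channels and pulled-back effects -/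

section Channels

variable {A K X : Type*} [Fintype A] [DecidableEq A] [Fintype K] [DecidableEq K] [Fintype X]

/-- Dephasing has a Kraus form with the projections |a⟩⟨a| ⊗ 1, written `D a` below. -/
theorem ampliation_dephase_posSemidef {k : ℕ} {Z : Matrix (A × Fin k) (A × Fin k) ℂ}
    (hZ : Z.PosSemidef) : (ampliation (Fin k) (dephase A) Z).PosSemidef := by
  let D : A → Matrix (A × Fin k) (A × Fin k) ℂ := fun a =>
    Matrix.diagonal fun p => if p.1 = a then 1 else 0
  have h : ampliation (Fin k) (dephase A) Z = ∑ a, D a * Z * (D a).conjTranspose := by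
    ext p q
    rw [Matrix.sum_apply]
    simp only [D, Matrix.diagonal_conjTranspose, Matrix.mul_diagonal, Matrix.diagonal_mul]
    simp only [ampliation, dephase_apply, LinearMap.coe_mk, AddHom.coe_mk, Matrix.of_apply,
      Matrix.diagonal_apply, Matrix.diag_apply]
    by_cases hpq : p.1 = q.1
    · obtain ⟨a, k⟩ := p
      obtain ⟨b, l⟩ := q
      obtain rfl : a = b := hpq
      simp
    · rw [if_neg hpq]
      refine (Finset.sum_eq_zero fun a _ => ?_).symm
      by_cases h : p.1 = a
      · have h' : q.1 ≠ a := fun h' => hpq (h.trans h'.symm)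
        simp [h']
      · simp [h]
  rw [h]
  exact Matrix.posSemidef_sum _ fun a _ => hZ.mul_mul_conjTranspose_same (D a)

/-- The channel `E ∘ Δ`. -/
def Channel.compDephase (E : Channel A) : Channel A where
  toMap := E.toMap ∘ₗ dephase A
  completelyPositive k Z hZ :=
    E.completelyPositive k _ (ampliation_dephase_posSemidef hZ)
  trace_map Z := by
    rw [LinearMap.comp_apply, E.trace_map]
    exact Matrix.trace_diagonal Z.diag

theorem dephase_idem (P : Matrix A A ℂ) : dephase A (dephase A P) = dephase A P :=
  congrArg Matrix.diagonal (Matrix.diag_diagonal P.diag)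

theorem Channel.compDephase_isDetectionIncoherent (E : Channel A) :
    E.compDephase.IsDetectionIncoherent := by
  ext1 Z
  simp only [Channel.compDephase, LinearMap.comp_apply, dephase_idem]

theorem Measurement.comp_effect_apply (M : Measurement A X) (E : Channel A) (x : X) (a b : A) :
    (M.comp E).effect x a b = (M.effect x * E.toMap (Matrix.single b a 1)).trace := rfl

theorem Channel.tensorId_apply (E : Channel A) (Z : Matrix (A × K) (A × K) ℂ) (p q : A × K) :
    (E.tensorId K).toMap Z p q = E.toMap (Matrix.of fun a b => Z (a, p.2) (b, q.2)) p.1 q.1 := rfl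

theorem Channel.compDephase_apply (E : Channel A) (Z : Matrix A A ℂ) :
    E.compDephase.toMap Z = E.toMap (dephase A Z) := rfl

/-- The effects of the incoherent-basis measurement preceded by `E`. -/
theorem incoherentBasis_comp_effect_apply (E : Channel A) (i a b : A) :
    ((incoherentBasisMeasurement A).comp E).effect i a b =
      E.toMap (Matrix.single b a 1) i i := by
  rw [Measurement.comp_effect_apply, incoherentBasisMeasurement, Matrix.trace_single_mul, one_smul]

theorem dephase_single_of_ne {a b : A} (h : a ≠ b) : dephase A (Matrix.single a b (1 : ℂ)) = 0 := by
  rw [dephase_apply, Matrix.diag_single_of_ne _ _ _ h]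
  exact Matrix.diagonal_zero

theorem dephase_single_self (a : A) :
    dephase A (Matrix.single a a (1 : ℂ)) = Matrix.single a a 1 := by
  rw [dephase_apply, Matrix.diag_single_same, Matrix.diagonal_single]

/-- The adjoint of E ∘ Δ is Δ ∘ E†. Hence E ∘ Δ realizes the optimal incoherent measurement as a
channel, which makes it the minimizing F. -/
theorem incoherentBasis_comp_compDephase_effect (E : Channel A) (i : A) :
    ((incoherentBasisMeasurement A).comp E.compDephase).effect i =
      ((incoherentBasisMeasurement A).comp E).dephased.effect i := by
  ext a b
  rw [incoherentBasis_comp_effect_apply, Measurement.dephased_effect, dephase_apply,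
    Matrix.diagonal_apply, Channel.compDephase_apply]
  split_ifs with h
  · subst h
    rw [dephase_single_self, Matrix.diag_apply, incoherentBasis_comp_effect_apply]
  · rw [dephase_single_of_ne (Ne.symm h), map_zero, Matrix.zero_apply]

/-- The entry (a, b) of effect i is ⟨i|F(|b⟩⟨a|)|i⟩. For a ≠ b, Δ annihilates |b⟩⟨a|, so Δ ∘ F does
too. -/
theorem Channel.IsDetectionIncoherent.comp_isIncoherent {F : Channel A}
    (hF : F.IsDetectionIncoherent) : ((incoherentBasisMeasurement A).comp F).IsIncoherent := by
  intro i
  ext a b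
  rw [dephase_apply, Matrix.diagonal_apply]
  split_ifs with h
  · rw [h, Matrix.diag_apply]
  · have h1 := congrFun (congrFun (LinearMap.congr_fun hF (Matrix.single b a 1)) i) i
    simp only [LinearMap.comp_apply, dephase_single_of_ne (Ne.symm h), map_zero] at h1
    rw [incoherentBasis_comp_effect_apply]
    simpa [dephase_apply] using h1.symm

theorem Measurement.IsIncoherent.effect_eq {M : Measurement A X} (hM : M.IsIncoherent) (x : X) :
    M.effect x = Matrix.diagonal fun a => ((M.effect x a a).re : ℂ) := by
  rw [← dephase_eq_diagonal (M.posSemidef x), hM x]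

theorem Measurement.IsIncoherent.comp_effect {M : Measurement A X} (hM : M.IsIncoherent)
    (E : Channel A) (x : X) : (M.comp E).effect x =
      ∑ i, ((M.effect x i i).re : ℂ) • ((incoherentBasisMeasurement A).comp E).effect i := by
  ext a b
  simp only [Matrix.sum_apply, Matrix.smul_apply, incoherentBasis_comp_effect_apply]
  rw [Measurement.comp_effect_apply, hM.effect_eq x]
  simp [Matrix.trace, Matrix.diagonal_mul]

open scoped Kronecker in
theorem Measurement.IsIncoherent.comp_tensorId_effect {M : Measurement (A × K) X}
    (hM : M.IsIncoherent) (E : Channel A) (x : X) : (M.comp (E.tensorId K)).effect x =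
      ∑ p : A × K, ((M.effect x p p).re : ℂ) •
        (((incoherentBasisMeasurement A).comp E).effect p.1 ⊗ₖ Matrix.single p.2 p.2 1) := by
  -- The trace sees only the diagonal ancilla blocks, and a matrix unit has a nonzero one only when
  -- k = l.
  have hblock : ∀ (a b : A) (k l m : K),
      (Matrix.of fun c d => Matrix.single (b, l) (a, k) (1 : ℂ) (c, m) (d, m)) =
        if m = k ∧ m = l then Matrix.single b a 1 else 0 := by
    intro a b k l m
    ext c d
    split_ifs with h
    · obtain ⟨rfl, rfl⟩ := h
      simp [Matrix.single_apply]
    · simp only [Matrix.of_apply, Matrix.single_apply, Prod.mk.injEq, Matrix.zero_apply]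
      exact if_neg fun h' => h ⟨h'.2.2.symm, h'.1.2.symm⟩
  ext ⟨a, k⟩ ⟨b, l⟩
  simp only [Matrix.sum_apply, Matrix.smul_apply, Matrix.kroneckerMap_apply,
    incoherentBasis_comp_effect_apply]
  rw [Measurement.comp_effect_apply, hM.effect_eq x]
  simp only [Matrix.trace, Matrix.diag_apply, Matrix.diagonal_mul, Channel.tensorId_apply,
    hblock, Matrix.diagonal_apply_eq,
    Complex.ofReal_re, smul_eq_mul]
  refine Finset.sum_congr rfl fun p _ => ?_
  rw [Matrix.single_apply]
  split_ifs <;> simp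

end Channels

/-! ### Mixtures and tensor products of diagonal matrices -/

section DiagonalMatrices

variable {A K : Type*} [DecidableEq A] [DecidableEq K]

theorem sum_smul_diagonal {J : Type*} [Fintype J] (c : J → ℝ) (q : J → A → ℝ) :
    ∑ j, (c j : ℂ) • Matrix.diagonal (fun a => (q j a : ℂ)) =
      Matrix.diagonal fun a => ((∑ j, c j * q j a : ℝ) : ℂ) := by
  ext a b
  rw [Matrix.sum_apply, Matrix.diagonal_apply]
  split_ifs with h
  · subst h
    simp
  · simp [h]

open scoped Kronecker in
theorem diagonal_kronecker_single (q : A → ℝ) (k : K) :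
    (Matrix.diagonal fun a => (q a : ℂ)) ⊗ₖ Matrix.single k k (1 : ℂ) =
      Matrix.diagonal fun p : A × K => ((q p.1 * if p.2 = k then 1 else 0 : ℝ) : ℂ) := by
  rw [← Matrix.diagonal_single, Matrix.diagonal_kronecker_diagonal]
  congr 1
  ext p
  rw [Pi.single_apply]
  split_ifs <;> simp

end DiagonalMatrices

/-! ### The measurement-cohering power -/

section CoheringPower

variable {A K X : Type*} [Fintype A] [DecidableEq A] [Fintype K] [DecidableEq K] [Fintype X]

theorem measRelEntropy_congr {M F F' : Measurement A X} (h : ∀ x, F.effect x = F'.effect x) :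
    measRelEntropy M F = measRelEntropy M F' := by
  simp only [measRelEntropy, h]

theorem Measurement.diag_re_nonneg (M : Measurement A X) (x : X) (a : A) :
    0 ≤ (M.effect x a a).re := posSemidef_diag_re_nonneg (M.posSemidef x) a

theorem Measurement.effect_diag_eq_zero {M F : Measurement A X} {x : X}
    (h : ∀ b, F.effect x b b = 0 → M.effect x b b = 0) (b : A) (hb : (F.effect x b b).re = 0) :
    M.effect x b b = 0 := h b ((posSemidef_diag_eq_zero_iff (F.posSemidef x) b).mp hb)

/-- The effects of M ∘ E and their dephasings are mixtures of the T_i and their dephasings with the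
same stochastic weights, so coarse graining applies. -/
theorem measCoherence_comp_le (E : Channel A) {M : Measurement A X} (hM : M.IsIncoherent) :
    measCoherence (M.comp E) ≤ measCoherence ((incoherentBasisMeasurement A).comp E) := by
  set T := (incoherentBasisMeasurement A).comp E with hT
  rw [measCoherence_eq, measCoherence_eq,
    measRelEntropy_eq_coe (M.comp E).dephased_isIncoherent (M.comp E).dephased_support,
    measRelEntropy_eq_coe T.dephased_isIncoherent T.dephased_support, EReal.coe_le_coe_iff]
  refine mul_le_mul_of_nonneg_left ?_ (by positivity)
  refine le_trans (le_of_eq (Finset.sum_congr rfl fun x _ => ?_))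
    (sum_diagRelEntropy_le M.diag_re_nonneg M.sum_diag_re T.posSemidef T.dephased.diag_re_nonneg
      fun i b hb => Measurement.effect_diag_eq_zero (T.dephased_support i) b hb)
  simp only [Measurement.dephased_diag, hM.comp_effect, ← hT]
  congr 1
  ext b
  simp [Matrix.sum_apply, Complex.re_sum]

open scoped Kronecker in
-- Coarse graining applies to the operators T_i ⊗ |k⟩⟨k|. Each k contributes the same total, and the
-- resulting factor |K| is offset by the dimension in the normalization.
theorem measRelEntropy_comp_tensorId_le (E : Channel A) {F : Channel A}
    (hF : F.IsDetectionIncoherent) {M : Measurement (A × K) X} (hM : M.IsIncoherent)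
    [Nonempty K] :
    measRelEntropy (M.comp (E.tensorId K)) (M.comp (F.tensorId K)) ≤
      measRelEntropy ((incoherentBasisMeasurement A).comp E)
        ((incoherentBasisMeasurement A).comp F) := by
  set T := (incoherentBasisMeasurement A).comp E with hT
  set N := (incoherentBasisMeasurement A).comp F with hN
  have hNi : N.IsIncoherent := hF.comp_isIncoherent
  by_cases h : ∀ i b, N.effect i b b = 0 → T.effect i b b = 0
  swap
  · rw [measRelEntropy_eq_top hNi h]
    exact le_top
  let P : A × K → Matrix (A × K) (A × K) ℂ := fun p => T.effect p.1 ⊗ₖ Matrix.single p.2 p.2 1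
  let q : A × K → A × K → ℝ := fun p r =>
    (N.effect p.1 r.1 r.1).re * if r.2 = p.2 then 1 else 0
  have hP : ∀ p, (P p).PosSemidef := fun p => posSemidef_kronecker_single (T.posSemidef p.1) p.2
  have hq : ∀ p r, 0 ≤ q p r := fun p r =>
    mul_nonneg (N.diag_re_nonneg _ _) (by split_ifs <;> norm_num)
  have hPq : ∀ p r, q p r = 0 → P p r r = 0 := by
    intro p r hpr
    rcases mul_eq_zero.mp hpr with h' | h'
    · simp [P, Measurement.effect_diag_eq_zero (h p.1) r.1 h']
    · have : r.2 ≠ p.2 := fun h'' => by simp [h''] at h'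
      simp [P, this.symm]
  have hTx : ∀ x, (M.comp (E.tensorId K)).effect x = ∑ p, ((M.effect x p p).re : ℂ) • P p :=
    hM.comp_tensorId_effect E
  have hNx : ∀ x, (M.comp (F.tensorId K)).effect x =
      Matrix.diagonal fun r => ((∑ p, (M.effect x p p).re * q p r : ℝ) : ℂ) := by
    intro x
    rw [hM.comp_tensorId_effect F, ← sum_smul_diagonal]
    refine Finset.sum_congr rfl fun p _ => ?_
    rw [← hN, hNi.effect_eq p.1, diagonal_kronecker_single]
  have hNxi : (M.comp (F.tensorId K)).IsIncoherent := by
    intro x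
    rw [hNx, dephase_apply, Matrix.diag_diagonal]
  rw [measRelEntropy_eq_coe hNxi, measRelEntropy_eq_coe hNi h, EReal.coe_le_coe_iff]
  · have hcore := sum_diagRelEntropy_le M.diag_re_nonneg M.sum_diag_re hP hq hPq
    simp only [hTx, hNx, Matrix.diagonal_apply_eq, Complex.ofReal_re]
    refine (mul_le_mul_of_nonneg_left hcore (by positivity)).trans (le_of_eq ?_)
    have hD : ∀ p, diagRelEntropy (P p) (q p) =
        diagRelEntropy (T.effect p.1) fun b => (N.effect p.1 b b).re := fun p =>
      diagRelEntropy_kronecker_single (T.posSemidef p.1).1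
        (fun b => (N.effect p.1 b b).re) p.2
    simp only [hD, Fintype.sum_prod_type, Finset.sum_const, Finset.card_univ, Fintype.card_prod,
      nsmul_eq_mul, ← Finset.mul_sum]
    have hK : (Fintype.card K : ℝ) ≠ 0 := by simp
    push_cast
    rw [mul_inv, mul_assoc, inv_mul_cancel_left₀ hK]
  · intro x r hr
    rw [hNx, Matrix.diagonal_apply_eq, Complex.ofReal_eq_zero] at hr
    rw [hTx]
    exact sum_ofReal_smul_diag_eq_zero (M.diag_re_nonneg x) hq hPq r hr

/-- The incoherent-basis measurement on a system with a trivial ancilla. -/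
def incoherentBasisMeasurementAncilla (A : Type*) [Fintype A] [DecidableEq A] :
    Measurement (A × Fin 1) A where
  effect i := (incoherentBasisMeasurement (A × Fin 1)).effect (i, 0)
  posSemidef i := (incoherentBasisMeasurement (A × Fin 1)).posSemidef (i, 0)
  sum_effect := by
    rw [← (incoherentBasisMeasurement (A × Fin 1)).sum_effect, Fintype.sum_prod_type]
    simp

theorem incoherentBasisMeasurement_isIncoherent :
    (incoherentBasisMeasurement A).IsIncoherent := dephase_single_self

theorem incoherentBasisMeasurementAncilla_isIncoherent :
    (incoherentBasisMeasurementAncilla A).IsIncoherent :=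
  fun i => dephase_single_self (i, (0 : Fin 1))

open scoped Kronecker in
theorem incoherentBasisMeasurementAncilla_comp_effect (E : Channel A) (i : A) :
    ((incoherentBasisMeasurementAncilla A).comp (E.tensorId (Fin 1))).effect i =
      ((incoherentBasisMeasurement A).comp E).effect i ⊗ₖ Matrix.single 0 0 1 := by
  rw [incoherentBasisMeasurementAncilla_isIncoherent.comp_tensorId_effect,
    Finset.sum_eq_single (i, 0)]
  · simp [incoherentBasisMeasurementAncilla, incoherentBasisMeasurement]
  · intro p _ hp
    simp [incoherentBasisMeasurementAncilla, incoherentBasisMeasurement, hp.symm]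
  · simp

open scoped Kronecker in
theorem relEntropy_kronecker_single {P : Matrix A A ℂ} (hP : P.PosSemidef) (q : A → ℝ) (k : K) :
    relEntropy (P ⊗ₖ Matrix.single k k 1)
      ((Matrix.diagonal fun a => (q a : ℂ)) ⊗ₖ Matrix.single k k 1) =
        relEntropy P (Matrix.diagonal fun a => (q a : ℂ)) := by
  rw [diagonal_kronecker_single]
  by_cases h : ∀ b, q b = 0 → P b b = 0
  · rw [relEntropy_diagonal hP h, relEntropy_diagonal (posSemidef_kronecker_single hP k),
      diagRelEntropy_kronecker_single hP.1]
    rintro ⟨b, l⟩ hb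
    by_cases hl : k = l
    · simp [h b (by simpa [hl] using hb)]
    · simp [hl]
  · rw [relEntropy_diagonal_eq_top hP h,
      relEntropy_diagonal_eq_top (posSemidef_kronecker_single hP k)]
    exact fun h' => h fun b hb => by simpa using h' (b, k) (by simp [hb])

theorem measRelEntropy_incoherentBasisMeasurementAncilla (E : Channel A) {F : Channel A}
    (hF : F.IsDetectionIncoherent) :
    measRelEntropy ((incoherentBasisMeasurementAncilla A).comp (E.tensorId (Fin 1)))
      ((incoherentBasisMeasurementAncilla A).comp (F.tensorId (Fin 1))) =
    measRelEntropy ((incoherentBasisMeasurement A).comp E)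
      ((incoherentBasisMeasurement A).comp F) := by
  rw [measRelEntropy, measRelEntropy]
  congr 1
  · simp
  · refine Finset.sum_congr rfl fun i _ => ?_
    rw [incoherentBasisMeasurementAncilla_comp_effect,
      incoherentBasisMeasurementAncilla_comp_effect, hF.comp_isIncoherent.effect_eq i]
    exact relEntropy_kronecker_single
      (((incoherentBasisMeasurement A).comp E).posSemidef i) _ 0

variable {d : ℕ}

theorem isGreatest_distinguishabilityValues (E : Channel (Fin d)) {F : Channel (Fin d)}
    (hF : F.IsDetectionIncoherent) :
    IsGreatest (distinguishabilityValues E F)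
      (measRelEntropy ((incoherentBasisMeasurement (Fin d)).comp E)
        ((incoherentBasisMeasurement (Fin d)).comp F)) := by
  refine ⟨⟨1, d, _, one_pos, incoherentBasisMeasurementAncilla_isIncoherent,
    (measRelEntropy_incoherentBasisMeasurementAncilla E hF).symm⟩, ?_⟩
  rintro _ ⟨k, n, M, hk, hM, rfl⟩
  have : NeZero k := ⟨hk.ne'⟩
  exact measRelEntropy_comp_tensorId_le E hF hM

theorem distinguishability_eq (E : Channel (Fin d)) {F : Channel (Fin d)}
    (hF : F.IsDetectionIncoherent) :
    distinguishability E F = measRelEntropy ((incoherentBasisMeasurement (Fin d)).comp E)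
        ((incoherentBasisMeasurement (Fin d)).comp F) :=
  (isGreatest_distinguishabilityValues E hF).isLUB.sSup_eq

/-- Every admissible F supplies a competitor in the definition of C_m, which gives the lower bound;
E ∘ Δ supplies the optimal competitor. -/
theorem isLeast_measCoheringPowerValues (E : Channel (Fin d)) :
    IsLeast (measCoheringPowerValues E)
      (measCoherence ((incoherentBasisMeasurement (Fin d)).comp E)) := by
  constructor
  · refine ⟨E.compDephase, E.compDephase_isDetectionIncoherent, ?_⟩
    rw [distinguishability_eq E E.compDephase_isDetectionIncoherent, measCoherence_eq]
    exact measRelEntropy_congr fun i => (incoherentBasis_comp_compDephase_effect E i).symm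
  · rintro _ ⟨F, hF, rfl⟩
    rw [distinguishability_eq E hF]
    exact sInf_le ⟨_, hF.comp_isIncoherent, rfl⟩

theorem isGreatest_generatedCoherenceValues (E : Channel (Fin d)) :
    IsGreatest (generatedCoherenceValues E)
      (measCoherence ((incoherentBasisMeasurement (Fin d)).comp E)) := by
  refine ⟨⟨d, _, incoherentBasisMeasurement_isIncoherent, rfl⟩, ?_⟩
  rintro _ ⟨n, M, hM, rfl⟩
  exact measCoherence_comp_le E hM

end CoheringPower

end MeasCoh

theorem theorem2 (d : ℕ) [NeZero d] (E : MeasCoh.Channel (Fin d)) :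
    -- the two equalities
    (MeasCoh.measCoheringPower E = sSup (MeasCoh.generatedCoherenceValues E) ∧
      sSup (MeasCoh.generatedCoherenceValues E) =
        MeasCoh.measCoherence ((MeasCoh.incoherentBasisMeasurement (Fin d)).comp E)) ∧
    -- all the suprema and infima involved are maxima and minima
    IsLeast (MeasCoh.measCoheringPowerValues E) (MeasCoh.measCoheringPower E) ∧
    (∀ F : MeasCoh.Channel (Fin d), F.IsDetectionIncoherent →
      IsGreatest (MeasCoh.distinguishabilityValues E F) (MeasCoh.distinguishability E F)) ∧
    IsGreatest (MeasCoh.generatedCoherenceValues E)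
      (sSup (MeasCoh.generatedCoherenceValues E)) ∧
    (∀ (n : ℕ) (M : MeasCoh.Measurement (Fin d) (Fin n)), M.IsIncoherent →
      IsLeast (MeasCoh.measCoherenceValues (M.comp E)) (MeasCoh.measCoherence (M.comp E))) := by
  have hP : MeasCoh.measCoheringPower E = _ :=
    (MeasCoh.isLeast_measCoheringPowerValues E).isGLB.sInf_eq
  have hG := (MeasCoh.isGreatest_generatedCoherenceValues E).isLUB.sSup_eq
  refine ⟨⟨hP.trans hG.symm, hG⟩, ?_, fun F hF => ?_, ?_, fun n M _ => ?_⟩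
  · rw [hP]
    exact MeasCoh.isLeast_measCoheringPowerValues E
  · rw [MeasCoh.distinguishability_eq E hF]
    exact MeasCoh.isGreatest_distinguishabilityValues E hF
  · rw [hG]
    exact MeasCoh.isGreatest_generatedCoherenceValues E
  · rw [MeasCoh.measCoherence_eq]
    exact MeasCoh.isLeast_measCoherenceValues (M.comp E)
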